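/- All graphs are finite, simple, loopless and undirected. A decomposition of a graph $F$ is a pair $(T,\beta)$ of a graph $T$ and a map $\beta\colon V(T)\to 2^{V(F)}$ such that the bags $\beta(t)$ cover $V(F)$, every edge of $F$ is contained in some bag, and for every $x\in V(F)$ the set $\{t \mid x\in\beta(t)\}$ is connected in $T$; its width is $\max_t|\beta(t)|-1$. It is a path (cycle) decomposition if $T$ is a path (a cycle). The cyclewidth of $F$ is the minimum width of a cycle decomposition of $F$. Two graphs $G,H$ are homomorphism indistinguishable over a class $\mathcal F$ of graphs if $\hom(F,G)=\hom(F,H)$ for all $F\in\mathcal F$, where $\hom$ counts homomorphisms. A $(k+1,k+1)$-bilabelled graph is a triple $\boldsymbol B=(B,\vec u,\vec v)$ with $B$ a graph and $\vec u,\vec v\in V(B)^{k+1}$ (repetitions allowed). Its reverse is $\boldsymbol B^*=(B,\vec v,\vec u)$. The concatenation of $(B,\vec u,\vec v)$ and $(B',\vec u',\vec v')$ is obtained from the disjoint union of $B$ and $B'$ by identifying $\vec v_i$ with $\vec u'_i$ for all $i$ and merging multiple edges, with labels $\vec u$ and $\vec v'$; it yields a bilabelled (simple) graph provided that no edge becomes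 a self-loop. For a graph $G$, let $\boldsymbol B_G\in\mathbb C^{V(G)^{k+1}\times V(G)^{k+1}}$ be the matrix whose entry at $(\vec x,\vec y)$ is the number of homomorphisms $h\colon B\to G$ with $h(\vec u_i)=\vec x_i$ and $h(\vec v_i)=\vec y_i$ for all $i$. Let $\mathcal{PW}^k$ be the class of $(k+1,k+1)$-bilabelled graphs $(B,\vec u,\vec v)$ such that $B$ has a path decomposition of width at most $k$ whose two leaf bags consist precisely of the vertices occurring in $\vec u$ and in $\vec v$, respectively. Regarding bilabelled graphs up to isomorphism, a finite set $\mathcal B^k\subseteq\mathcal{PW}^k$ is called $k$-basal if it contains the identity graph (with $k+1$ isolated vertices, the $i$-th carrying the $i$-th in-label and the $i$-th out-label), is closed under taking reverses, and every element of $\mathcal{PW}^k$ is a concatenation of a sequence of elements of $\mathcal B^k$. **Theorem.** Let $k\ge 1$, let $\mathcal B^k$ be a $k$-basal set, and let $G$ and $H$ be graphs. Then the following are equivalent: 1. $G$ and $H$ are homomorphism indistinguishable over the class of graphs of cyclewidth at most $k$. 2. There exists a unitary matrix $U\in\mathbb C^{V(H)^{k+1}\times V(G)^{k+1}}$ such that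 $U\boldsymbol B_G=\boldsymbol B_H U$ for all $\boldsymbol B\in\mathcal B^k$. -/

import Mathlib

open scoped Matrix

/-- A decomposition `(T, β)` of the graph `F`: the bags `β t` cover the vertices of `F`, every edge
lies in a bag, and the nodes whose bag contains a given vertex are connected in `T`. -/
structure IsDecomposition {ι V : Type*} (T : SimpleGraph ι) (F : SimpleGraph V)
    (β : ι → Finset V) : Prop where
  cover : ∀ x : V, ∃ t, x ∈ β t
  edge : ∀ x y : V, F.Adj x y → ∃ t, x ∈ β t ∧ y ∈ β t
  connected : ∀ x : V, (T.induce {t | x ∈ β t}).Connected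

/-- The width of a decomposition is the maximal size of a bag minus one; this says that it is at
most `k`. -/
def BagsWidthAtMost {ι V : Type*} (β : ι → Finset V) (k : ℕ) : Prop :=
  ∀ t, (β t).card ≤ k + 1

/-- `F` has cyclewidth at most `k`: it has a decomposition of width at most `k` over a cycle
(cycles have at least three nodes). -/
def CyclewidthAtMost (k : ℕ) {V : Type*} (F : SimpleGraph V) : Prop :=
  ∃ (n : ℕ) (β : Fin n → Finset V), 3 ≤ n ∧
    IsDecomposition (SimpleGraph.cycleGraph n) F β ∧ BagsWidthAtMost β k

/-- `hom(F, G)`, the number of homomorphisms from `F` to `G`. -/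
noncomputable def homCount {X V : Type*} (F : SimpleGraph X) (G : SimpleGraph V) : ℕ :=
  Nat.card (F →g G)

/-- `G` and `H` admit equally many homomorphisms from every finite graph in the class `𝓕`. -/
def HomIndistinguishable (𝓕 : ∀ ⦃X : Type⦄, SimpleGraph X → Prop) {V W : Type*}
    (G : SimpleGraph V) (H : SimpleGraph W) : Prop :=
  ∀ (X : Type) [Finite X] (F : SimpleGraph X), 𝓕 F → homCount F G = homCount F H

/-- A finite simple graph with an `m`-tuple of in-labelled and an `n`-tuple of out-labelled
vertices; neither tuple need be injective. -/
structure BilabelledGraph (m n : ℕ) where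
  V : Type
  finite : Finite V
  graph : SimpleGraph V
  inn : Fin m → V
  out : Fin n → V

namespace BilabelledGraph

variable {l m n : ℕ}

/-- `P` and `Q` are isomorphic as bilabelled graphs. -/
def Isomorphic (P Q : BilabelledGraph m n) : Prop :=
  ∃ e : P.graph ≃g Q.graph, (∀ i, e (P.inn i) = Q.inn i) ∧ (∀ j, e (P.out j) = Q.out j)

/-- The reverse graph: the roles of in- and out-labels are interchanged. -/
def reverse (P : BilabelledGraph m n) : BilabelledGraph n m where
  V := P.V
  finite := P.finite
  graph := P.graph
  inn := P.out
  out := P.inn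

/-- The identity graph on `n` isolated vertices, the `i`-th of which carries the `i`-th in-label and
the `i`-th out-label. -/
def identity (n : ℕ) : BilabelledGraph n n where
  V := Fin n
  finite := inferInstance
  graph := ⊥
  inn := id
  out := id

/-- The identification used in the concatenation of `P` and `Q`: the `i`-th out-labelled vertex of
`P` with the `i`-th in-labelled vertex of `Q`. -/
def GlueRel (P : BilabelledGraph l m) (Q : BilabelledGraph m n) (a b : P.V ⊕ Q.V) : Prop :=
  ∃ i : Fin m, a = Sum.inl (P.out i) ∧ b = Sum.inr (Q.inn i)

/-- Vertices of the concatenation: the disjoint union modulo the equivalence relation generated by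
`GlueRel`. -/
abbrev GlueVertex (P : BilabelledGraph l m) (Q : BilabelledGraph m n) : Type :=
  Quot (GlueRel P Q)

/-- The identification of vertices does not turn an edge of `P` or `Q` into a self-loop, so that the
concatenation of `P` and `Q` is again a simple graph. -/
def Composable (P : BilabelledGraph l m) (Q : BilabelledGraph m n) : Prop :=
  ∀ a b : P.V ⊕ Q.V, (P.graph ⊕g Q.graph).Adj a b → Quot.mk (GlueRel P Q) a ≠ Quot.mk _ b

/-- Concatenation (series composition). Multiple edges are merged. -/
def concat (P : BilabelledGraph l m) (Q : BilabelledGraph m n) (h : Composable P Q) :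
    BilabelledGraph l n where
  V := GlueVertex P Q
  finite := by
    have := P.finite
    have := Q.finite
    infer_instance
  graph :=
    { Adj := fun x y => ∃ a b : P.V ⊕ Q.V,
        (P.graph ⊕g Q.graph).Adj a b ∧ Quot.mk _ a = x ∧ Quot.mk _ b = y
      symm := ⟨fun _ _ ⟨a, b, hab, ha, hb⟩ => ⟨b, a, hab.symm, hb, ha⟩⟩
      loopless := ⟨fun _ ⟨a, b, hab, ha, hb⟩ => h a b hab (ha.trans hb.symm)⟩ }
  inn := fun i => Quot.mk _ (Sum.inl (P.inn i))
  out := fun j => Quot.mk _ (Sum.inr (Q.out j))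

/-- `P` is, up to isomorphism, a concatenation `B₁ ⋯ Bᵣ` with `r ≥ 1` of members of `S`. -/
inductive Generated (S : Set (BilabelledGraph n n)) : BilabelledGraph n n → Prop
  | of_mem (B : BilabelledGraph n n) : B ∈ S → Generated S B
  | concat (P B : BilabelledGraph n n) (h : Composable P B) :
      Generated S P → B ∈ S → Generated S (P.concat B h)
  | of_isomorphic (P Q : BilabelledGraph n n) : Isomorphic P Q → Generated S P → Generated S Q

/-- The class `PWᵏ` of bilabelled graphs of pathwidth at most `k`: the underlying graph has a path
decomposition of width at most `k` whose two leaf bags consist precisely of the in-labelled and of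
the out-labelled vertices, respectively. (Repeating a bag, a path with one node can always be
replaced by a path with two nodes.) -/
def PathwidthAtMost (k : ℕ) (P : BilabelledGraph (k + 1) (k + 1)) : Prop :=
  ∃ (N : ℕ) (β : Fin (N + 2) → Finset P.V),
    IsDecomposition (SimpleGraph.pathGraph (N + 2)) P.graph β ∧ BagsWidthAtMost β k ∧
    (β 0 : Set P.V) = Set.range P.inn ∧ (β (Fin.last (N + 1)) : Set P.V) = Set.range P.out

/-- `S` is a `k`-basal set (bilabelled graphs being considered up to isomorphism). -/
structure IsBasal (k : ℕ) (S : Set (BilabelledGraph (k + 1) (k + 1))) : Prop where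
  finite : S.Finite
  pathwidth : ∀ B ∈ S, PathwidthAtMost k B
  identity : ∃ B ∈ S, Isomorphic B (BilabelledGraph.identity (k + 1))
  reverse : ∀ B ∈ S, ∃ B' ∈ S, Isomorphic B' B.reverse
  generates : ∀ P, PathwidthAtMost k P → Generated S P

/-- The homomorphism matrix `P_G`: its entry at `(x, y)` is the number of homomorphisms from `P` to
`G` that send the in-labelled vertices to `x` and the out-labelled vertices to `y`. -/
noncomputable def homMatrix (P : BilabelledGraph m n) {V : Type*} (G : SimpleGraph V) :
    Matrix (Fin m → V) (Fin n → V) ℂ :=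
  fun x y => (Nat.card
    {h : P.graph →g G // (∀ i, h (P.inn i) = x i) ∧ (∀ j, h (P.out j) = y j)} : ℂ)

end BilabelledGraph

/-! Gluing bilabelled graphs multiplies their homomorphism matrices, and identifying the in-labels
with the out-labels takes a trace. A word in the basal set thus has a trace that counts
homomorphisms from a graph obtained by bending a path decomposition of width at most `k` into a
cycle. When a gluing or the closing would create a self-loop, no compatible homomorphism exists, and
the quantity is zero for `G` and `H` alike.

From indistinguishability to `U`: all words have equal traces over `G` and `H`, and reversal makes
the two families closed under adjoints. Specht's theorem
(`exists_unitary_intertwiner_of_trace_words_eq`) then supplies the unitary. It is proved by taking a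
partial isometry intertwiner of maximal rank and enlarging it whenever it is not isometric
(`exists_intertwiner_between_complements`).

From `U` to indistinguishability: a cycle decomposition with nonempty bags cuts `F` into pieces
spanned by consecutive bags. `homCount_eq_trace` writes the homomorphism count as the trace of the
product of their matrices. Each piece has pathwidth at most `k`, so it is generated by the basal set
and intertwined by `U`; conjugation by a unitary preserves the trace. -/

/-! ### Specht's theorem for families closed under adjoints -/

section Specht

open scoped ComplexOrder

variable {n m σ : Type*} [Fintype n] [DecidableEq n] [Fintype m]

/-- A subspace of a product of two matrix algebras has a finite orthonormal basis with respect to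
the trace inner product. -/
theorem exists_trace_orthonormal_expansion (C : Submodule ℂ (Matrix n n ℂ × Matrix m m ℂ)) :
    ∃ (r : ℕ) (c : Fin r → Matrix n n ℂ × Matrix m m ℂ), (∀ i, c i ∈ C) ∧
      ∀ d ∈ C, d = ∑ i, (((c i).1ᴴ * d.1).trace + ((c i).2ᴴ * d.2).trace) • c i := by
  have nonneg (M : Matrix n n ℂ) : 0 ≤ (Mᴴ * M).trace :=
    (Matrix.posSemidef_conjTranspose_mul_self M).trace_nonneg
  have nonneg' (M : Matrix m m ℂ) : 0 ≤ (Mᴴ * M).trace :=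
    (Matrix.posSemidef_conjTranspose_mul_self M).trace_nonneg
  let core : InnerProductSpace.Core ℂ C :=
    { inner := fun c d => (c.1.1ᴴ * d.1.1).trace + (c.1.2ᴴ * d.1.2).trace
      conj_inner_symm := fun c d => by
        simp only [map_add, ← Complex.star_def, ← Matrix.trace_conjTranspose,
          Matrix.conjTranspose_mul, Matrix.conjTranspose_conjTranspose]
      re_inner_nonneg := fun c => by
        have h := add_nonneg (nonneg c.1.1) (nonneg' c.1.2)
        exact (Complex.nonneg_iff.1 h).1
      add_left := fun c d e => by
        simp [add_mul, Matrix.conjTranspose_add]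
        ring
      smul_left := fun c d z => by
        simp [mul_add]
      definite := fun c h => by
        have h1 := (add_eq_zero_iff_of_nonneg (nonneg c.1.1) (nonneg' c.1.2)).1 h
        rw [Matrix.trace_conjTranspose_mul_self_eq_zero_iff,
          Matrix.trace_conjTranspose_mul_self_eq_zero_iff] at h1
        exact Subtype.ext (Prod.ext h1.1 h1.2) }
  let _ : NormedAddCommGroup C := core.toNormedAddCommGroup
  let _ : InnerProductSpace ℂ C := InnerProductSpace.ofCore core.toCore
  let b := stdOrthonormalBasis ℂ C
  refine ⟨_, fun i => (b i : Matrix n n ℂ × Matrix m m ℂ), fun i => (b i).2, fun d hd => ?_⟩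
  have h := congrArg Subtype.val (b.sum_repr' ⟨d, hd⟩)
  rw [AddSubmonoidClass.coe_finsetSum] at h
  exact h.symm

theorem Matrix.trace_eq_rank_of_isIdempotentElem {e : Matrix n n ℂ} (he : e * e = e) :
    e.trace = e.rank := by
  have h : IsIdempotentElem (Matrix.toLin' e) := by
    rw [IsIdempotentElem, Module.End.mul_eq_comp, ← Matrix.toLin'_mul, he]
  rw [← Matrix.trace_toLin'_eq, LinearMap.IsProj.trace (LinearMap.IsIdempotentElem.isProj_range _ h)]
  rfl

variable [DecidableEq m] in
/-- Equal traces of words persist when compressing to the complements of the initial and the final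
space of an intertwiner. -/
theorem trace_mul_eq_of_mem_span {A : σ → Matrix n n ℂ} {B : σ → Matrix m m ℂ}
    (htr : ∀ w : List σ, ((w.map A).prod).trace = ((w.map B).prod).trace)
    {T : Matrix m n ℂ} (hT : ∀ s, T * A s = B s * T) {c : Matrix n n ℂ × Matrix m m ℂ}
    (hc : c ∈ Submodule.span ℂ (Set.range fun w : List σ => ((w.map A).prod, (w.map B).prod))) :
    ((1 - Tᴴ * T) * c.1).trace = ((1 - T * Tᴴ) * c.2).trace := by
  -- Both properties are linear in the pair, so words suffice. Cyclicity of the trace then turns `Tᴴ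
  -- * T * c.1` into `T * Tᴴ * c.2`.
  have key : c.1.trace = c.2.trace ∧ T * c.1 = c.2 * T := by
    induction hc using Submodule.span_induction with
    | mem x hx =>
      obtain ⟨w, rfl⟩ := hx
      refine ⟨htr w, ?_⟩
      induction w with
      | nil => simp
      | cons s w ih =>
        simp only [List.map_cons, List.prod_cons] at ih ⊢
        rw [← Matrix.mul_assoc, hT, Matrix.mul_assoc, ih, Matrix.mul_assoc]
    | zero => simp
    | add x y _ _ hx hy => simp [hx.1, hy.1, hx.2, hy.2, Matrix.mul_add, Matrix.add_mul]
    | smul a x _ hx => simp [hx.1, hx.2]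
  rw [sub_mul, sub_mul, one_mul, one_mul, Matrix.trace_sub, Matrix.trace_sub, key.1,
    Matrix.mul_assoc, key.2, Matrix.trace_mul_comm, Matrix.mul_assoc, Matrix.trace_mul_comm (T * Tᴴ)]

/-- A nonzero matrix intertwiner has a nonzero partial isometry intertwiner in its polar
decomposition. -/
theorem exists_partial_isometry_of_ne_zero {X : Matrix m n ℂ} (hX : X ≠ 0) :
    ∃ g : Matrix n n ℂ, gᴴ = g ∧ X * g ≠ 0 ∧ X * g * (X * g)ᴴ * (X * g) = X * g ∧
      ∀ a, Commute (Xᴴ * X) a → Commute g a := by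
  have hsa : IsSelfAdjoint (Xᴴ * X) := (Matrix.isHermitian_conjTranspose_mul_self X).isSelfAdjoint
  have cont (f : ℝ → ℝ) : ContinuousOn f (spectrum ℝ (Xᴴ * X)) :=
    (Matrix.finite_real_spectrum (A := Xᴴ * X)).continuousOn f
  have psd : (Xᴴ * X).PosSemidef := Matrix.posSemidef_conjTranspose_mul_self X
  have spec : ∀ x ∈ spectrum ℝ (Xᴴ * X), 0 ≤ x := by
    intro x hx
    rw [psd.isHermitian.spectrum_real_eq_range_eigenvalues] at hx
    obtain ⟨i, rfl⟩ := hx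
    exact psd.eigenvalues_nonneg i
  -- Since `0⁻¹ = 0`, applying `f` to `Xᴴ * X` gives the pseudo-inverse of the absolute value of
  -- `X`, and `X` times it is the polar part.
  let f : ℝ → ℝ := fun x => (√x)⁻¹
  have hid : cfc (fun x : ℝ => x) (Xᴴ * X) = Xᴴ * X := cfc_id' ℝ _
  have hmul (u v : ℝ → ℝ) : cfc u (Xᴴ * X) * cfc v (Xᴴ * X) = cfc (fun x => u x * v x) (Xᴴ * X) :=
    (cfc_mul u v _ (cont u) (cont v)).symm
  have hg : (cfc f (Xᴴ * X))ᴴ = cfc f (Xᴴ * X) := (cfc_predicate f (Xᴴ * X) : IsSelfAdjoint _)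
  refine ⟨cfc f (Xᴴ * X), hg, fun h0 => hX ?_, ?_, fun a ha => ha.cfc_real f⟩
  · rw [← Matrix.conjTranspose_mul_self_eq_zero]
    have h1 : Xᴴ * X * cfc f (Xᴴ * X) = 0 := by rw [Matrix.mul_assoc, h0, Matrix.mul_zero]
    have h2 : Xᴴ * X * cfc f (Xᴴ * X) * (Xᴴ * X * cfc f (Xᴴ * X)) = Xᴴ * X := by
      conv_rhs => rw [← hid]
      nth_rw 1 3 [← hid]
      rw [hmul, hmul]
      refine cfc_congr fun x hx => ?_
      rcases (spec x hx).eq_or_lt with rfl | hpos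
      · simp
      · have := Real.mul_self_sqrt hpos.le
        have := (Real.sqrt_pos.2 hpos).ne'
        simp only [f]
        field_simp
        nlinarith
    rw [← h2, h1, mul_zero]
  · rw [Matrix.conjTranspose_mul, hg]
    have h2 : cfc f (Xᴴ * X) * (cfc f (Xᴴ * X) * (Xᴴ * X) * cfc f (Xᴴ * X)) =
        cfc f (Xᴴ * X) := by
      nth_rw 3 [← hid]
      rw [hmul, hmul, hmul]
      refine cfc_congr fun x hx => ?_
      rcases (spec x hx).eq_or_lt with rfl | hpos
      · simp [f]
      · have := Real.mul_self_sqrt hpos.le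
        have := (Real.sqrt_pos.2 hpos).ne'
        simp only [f]
        field_simp
        nlinarith
    conv_rhs => rw [← h2]
    simp only [Matrix.mul_assoc]

variable [DecidableEq m]

/-- If a partial isometry intertwiner is not yet isometric, then some nonzero intertwiner maps the
complement of its initial space to the complement of its final space. -/
theorem exists_intertwiner_between_complements {A : σ → Matrix n n ℂ} {B : σ → Matrix m m ℂ}
    (htr : ∀ w : List σ, ((w.map A).prod).trace = ((w.map B).prod).trace)
    (hstar : ∀ s, ∃ t, A t = (A s)ᴴ ∧ B t = (B s)ᴴ)
    {T : Matrix m n ℂ} (hT : ∀ s, T * A s = B s * T) (hiso : T * Tᴴ * T = T)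
    (hp : 1 - Tᴴ * T ≠ 0) :
    ∃ X : Matrix m n ℂ, (∀ s, X * A s = B s * X) ∧ (1 - T * Tᴴ) * X * (1 - Tᴴ * T) ≠ 0 := by
  obtain ⟨r, c, hc, hexp⟩ := exists_trace_orthonormal_expansion
    (Submodule.span ℂ (Set.range fun w : List σ => ((w.map A).prod, (w.map B).prod)))
  set C := Submodule.span ℂ (Set.range fun w : List σ => ((w.map A).prod, (w.map B).prod))
  have hmul (s : σ) {d} (hd : d ∈ C) : (A s * d.1, B s * d.2) ∈ C := by
    induction hd using Submodule.span_induction with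
    | mem x hx =>
      obtain ⟨w, rfl⟩ := hx
      exact Submodule.subset_span ⟨s :: w, by simp⟩
    | zero => simp [← Prod.zero_eq_mk]
    | add x y _ _ hx hy => simpa [mul_add] using C.add_mem hx hy
    | smul a x _ hx => simpa using C.smul_mem a hx
  let φ (i : Fin r) (d : Matrix n n ℂ × Matrix m m ℂ) : ℂ :=
    ((c i).1ᴴ * d.1).trace + ((c i).2ᴴ * d.2).trace
  -- Averaging any `x` over an orthonormal basis of `C` gives an intertwiner: left multiplication by
  -- a generator preserves `C`, its adjoint is again left multiplication by a generator, and so the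
  -- same coefficients occur when expanding on either side of `x`.
  have hX (x : Matrix m n ℂ) (s : σ) :
      (∑ i, (c i).2 * x * (c i).1ᴴ) * A s = B s * ∑ i, (c i).2 * x * (c i).1ᴴ := by
    obtain ⟨t, hA, hB⟩ := hstar s
    have h1 (i : Fin r) : B s * (c i).2 = ∑ k, φ k (A s * (c i).1, B s * (c i).2) • (c k).2 := by
      simpa [Prod.snd_sum] using congrArg Prod.snd (hexp _ (hmul s (hc i)))
    have h2 (k : Fin r) :
        (c k).1ᴴ * A s = ∑ i, φ k (A s * (c i).1, B s * (c i).2) • (c i).1ᴴ := by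
      have h := congrArg (fun d => d.1ᴴ) (hexp _ (hmul t (hc k)))
      simp only [Prod.fst_sum, hA, hB, Matrix.conjTranspose_mul, Matrix.conjTranspose_conjTranspose,
        Matrix.conjTranspose_sum, Prod.smul_fst, Matrix.conjTranspose_smul] at h
      rw [h]
      refine Finset.sum_congr rfl fun i _ => ?_
      congr 1
      simp only [φ, star_add, ← Matrix.trace_conjTranspose, Matrix.conjTranspose_mul,
        Matrix.conjTranspose_conjTranspose, Matrix.mul_assoc]
    simp only [Matrix.mul_sum, Matrix.sum_mul]
    have h3 (k : Fin r) : (c k).2 * x * (c k).1ᴴ * A s =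
        ∑ i, φ k (A s * (c i).1, B s * (c i).2) • ((c k).2 * x * (c i).1ᴴ) := by
      rw [Matrix.mul_assoc, h2, Matrix.mul_sum]
      simp
    have h4 (i : Fin r) : B s * ((c i).2 * x * (c i).1ᴴ) =
        ∑ k, φ k (A s * (c i).1, B s * (c i).2) • ((c k).2 * x * (c i).1ᴴ) := by
      have h := congrArg (fun M => M * x * (c i).1ᴴ) (h1 i)
      simpa only [Matrix.sum_mul, Matrix.smul_mul, Matrix.mul_assoc] using h
    simp only [h3, h4]
    exact Finset.sum_comm
  by_contra! hzero
  have hzero' (x : Matrix m n ℂ) := hzero _ (hX x)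
  set p := 1 - Tᴴ * T with hpdef
  set q := 1 - T * Tᴴ with hqdef
  have hpp : pᴴ * p = p := by
    simp only [hpdef, Matrix.conjTranspose_sub, Matrix.conjTranspose_one, Matrix.conjTranspose_mul,
      Matrix.conjTranspose_conjTranspose, mul_sub, sub_mul, one_mul, mul_one]
    rw [show Tᴴ * T * (Tᴴ * T) = Tᴴ * (T * Tᴴ * T) by simp only [Matrix.mul_assoc], hiso]
    simp
  have hph : pᴴ = p := by simp [hpdef]
  have hτ (i : Fin r) : (p * (c i).1).trace = (q * (c i).2).trace :=
    trace_mul_eq_of_mem_span htr hT (hc i)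
  -- The compressed averages vanish for every `x`. Reading entry `(u, v)` at the matrix unit `single
  -- u v` and summing over `u` and `v` produces a product of two traces.
  have hsum : ∑ i, (q * (c i).2).trace * star (p * (c i).1).trace = 0 := by
    have h1 (i : Fin r) : star (p * (c i).1).trace = ((c i).1ᴴ * p).trace := by
      rw [← Matrix.trace_conjTranspose, Matrix.conjTranspose_mul, hph]
    simp only [h1]
    have hsingle (M : Matrix m m ℂ) (N : Matrix n n ℂ) (u : m) (v : n) :
        (M * Matrix.single u v (1 : ℂ) * N) u v = M u u * N v v := by
      rw [Matrix.mul_assoc, Matrix.mul_apply, Finset.sum_eq_single u]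
      · simp
      · intro b _ hb
        simp [hb]
      · simp
    have h2 : ∀ (u : m) (v : n), ∑ i, (q * (c i).2) u u * ((c i).1ᴴ * p) v v = 0 := by
      intro u v
      have h := congrFun (congrFun (hzero' (Matrix.single u v (1 : ℂ))) u) v
      rw [Matrix.mul_sum, Matrix.sum_mul, Matrix.sum_apply] at h
      rw [← show _ = (0 : ℂ) from h]
      refine Finset.sum_congr rfl fun i _ => ?_
      rw [show q * ((c i).2 * Matrix.single u v (1 : ℂ) * (c i).1ᴴ) * p =
        (q * (c i).2) * Matrix.single u v (1 : ℂ) * ((c i).1ᴴ * p) by simp only [Matrix.mul_assoc]]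
      exact (hsingle _ _ u v).symm
    simp only [Matrix.trace, Matrix.diag, Finset.sum_mul_sum]
    rw [Finset.sum_comm]
    refine Finset.sum_eq_zero fun u _ => ?_
    rw [Finset.sum_comm]
    exact Finset.sum_eq_zero fun v _ => h2 u v
  -- Equality of the compressed traces makes this a sum of squared moduli, so each trace is zero.
  -- Expanding the unit of `C` in the basis then gives trace zero for the projection `p`.
  simp only [← hτ] at hsum
  have hz := (Finset.sum_eq_zero_iff_of_nonneg fun i _ => mul_star_self_nonneg _).1 hsum
  have hone : ((1, 1) : Matrix n n ℂ × Matrix m m ℂ) ∈ C := Submodule.subset_span ⟨[], by simp⟩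
  have h1 := congrArg Prod.fst (hexp _ hone)
  refine hp ?_
  rw [← Matrix.trace_conjTranspose_mul_self_eq_zero_iff, hpp, ← mul_one p]
  rw [Prod.fst_sum] at h1
  change (1 : Matrix n n ℂ) = _ at h1
  rw [h1, Matrix.mul_sum, Matrix.trace_sum]
  refine Finset.sum_eq_zero fun i hi => ?_
  have := hz i hi
  rw [mul_eq_zero, star_eq_zero, or_self] at this
  simp [this]

/-- Specht's theorem for families: two families of matrices, compatibly closed under adjoints, all of
whose words have the same trace are simultaneously unitarily equivalent. -/
theorem exists_unitary_intertwiner_of_trace_words_eq {A : σ → Matrix n n ℂ} {B : σ → Matrix m m ℂ}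
    (htr : ∀ w : List σ, ((w.map A).prod).trace = ((w.map B).prod).trace)
    (hstar : ∀ s, ∃ t, A t = (A s)ᴴ ∧ B t = (B s)ᴴ) :
    ∃ U : Matrix m n ℂ, Uᴴ * U = 1 ∧ U * Uᴴ = 1 ∧ ∀ s, U * A s = B s * U := by
  have hadj {T : Matrix m n ℂ} (hT : ∀ s, T * A s = B s * T) (s : σ) : A s * Tᴴ = Tᴴ * B s := by
    obtain ⟨t, hA, hB⟩ := hstar s
    have := congrArg Matrix.conjTranspose (hT t)
    simpa [hA, hB] using this
  let P (T : Matrix m n ℂ) : Prop := (∀ s, T * A s = B s * T) ∧ T * Tᴴ * T = T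
  obtain ⟨T, ⟨hT, hiso⟩, hmax⟩ : ∃ T, P T ∧ ∀ T', P T' → T'.rank ≤ T.rank := by
    have hex : ∃ k, ∃ T, P T ∧ T.rank = k := ⟨_, 0, ⟨by simp, by simp⟩, rfl⟩
    have hb : ∀ k, (∃ T, P T ∧ T.rank = k) → k ≤ Fintype.card n := by
      rintro k ⟨T, -, rfl⟩
      exact T.rank_le_card_width
    classical
    obtain ⟨T, hT, hk⟩ := Nat.findGreatest_spec (P := fun k => ∃ T, P T ∧ T.rank = k)
      (hb _ hex.choose_spec) hex.choose_spec
    refine ⟨T, hT, fun T' hT' => ?_⟩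
    rw [hk]
    exact Nat.le_findGreatest (hb _ ⟨T', hT', rfl⟩) ⟨T', hT', rfl⟩
  have hiso' : Tᴴ * T * Tᴴ = Tᴴ := by
    simpa [Matrix.mul_assoc] using congrArg Matrix.conjTranspose hiso
  have hp : 1 - Tᴴ * T = 0 := by
    by_contra hp
    obtain ⟨Y, hY, hne⟩ := exists_intertwiner_between_complements htr hstar hT hiso hp
    set p := 1 - Tᴴ * T with hpdef
    set q := 1 - T * Tᴴ with hqdef
    have hph : pᴴ = p := by simp [hpdef]
    have hpT : p * Tᴴ = 0 := by simp [hpdef, Matrix.sub_mul, hiso']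
    have hqT : Tᴴ * q = 0 := by
      rw [hqdef, Matrix.mul_sub, ← Matrix.mul_assoc, hiso', Matrix.mul_one, sub_self]
    have hpp : p * p = p := by
      conv_lhs => rw [hpdef, mul_sub, mul_one, ← Matrix.mul_assoc, ← hpdef, hpT]
      simp
    have hpA (s : σ) : p * A s = A s * p := by
      rw [hpdef, sub_mul, mul_sub, one_mul, mul_one, Matrix.mul_assoc, hT, ← Matrix.mul_assoc,
        ← hadj hT, Matrix.mul_assoc]
    have hqB (s : σ) : q * B s = B s * q := by
      rw [hqdef, sub_mul, mul_sub, one_mul, mul_one, Matrix.mul_assoc, ← hadj hT,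
        ← Matrix.mul_assoc, hT, Matrix.mul_assoc]
    obtain ⟨g, hg, hne', hpi, hcomm⟩ := exists_partial_isometry_of_ne_zero hne
    -- Both projections commute with the families, so the compression still intertwines; its polar
    -- part `R` has initial and final spaces orthogonal to those of `T`.
    set X := q * Y * p with hXdef
    clear_value X
    have hX (s : σ) : X * A s = B s * X := by
      rw [hXdef, Matrix.mul_assoc, hpA, ← Matrix.mul_assoc, Matrix.mul_assoc q, hY,
        ← Matrix.mul_assoc, hqB]
      simp only [Matrix.mul_assoc]
    have hXp : X * p = X := by rw [hXdef, Matrix.mul_assoc, hpp]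
    have hpX : p * Xᴴ = Xᴴ := by simpa [hph] using congrArg Matrix.conjTranspose hXp
    have hgA (s : σ) : g * A s = A s * g :=
      hcomm _ (by rw [Commute, SemiconjBy, Matrix.mul_assoc, hX, ← Matrix.mul_assoc, ← hadj hX,
        Matrix.mul_assoc])
    have hgp : g * p = p * g :=
      hcomm _ (by rw [Commute, SemiconjBy, Matrix.mul_assoc, hXp, ← Matrix.mul_assoc, hpX])
    set R := X * g with hRdef
    clear_value R
    have hTR : Tᴴ * R = 0 := by
      simp [hRdef, hXdef, ← Matrix.mul_assoc, hqT]
    have hRT : R * Tᴴ = 0 := by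
      rw [hRdef, ← hXp, Matrix.mul_assoc, Matrix.mul_assoc, ← Matrix.mul_assoc p, ← hgp,
        Matrix.mul_assoc g, hpT]
      simp
    have hRT' : Rᴴ * T = 0 := by simpa using congrArg Matrix.conjTranspose hTR
    have hTR' : T * Rᴴ = 0 := by simpa using congrArg Matrix.conjTranspose hRT
    have hsum : (T + R)ᴴ * (T + R) = Tᴴ * T + Rᴴ * R := by
      simp [Matrix.conjTranspose_add, Matrix.mul_add, Matrix.add_mul, hTR, hRT']
    have hPsum : P (T + R) := by
      refine ⟨fun s => ?_, ?_⟩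
      · rw [Matrix.add_mul, Matrix.mul_add, hT, hRdef, Matrix.mul_assoc, hgA, ← Matrix.mul_assoc, hX,
          Matrix.mul_assoc]
      · rw [Matrix.mul_assoc, hsum]
        simp only [Matrix.mul_add, Matrix.add_mul, ← Matrix.mul_assoc, hiso, hpi, hRT, hTR']
        simp
    -- Ranks of partial isometries are traces of their initial projections, and these add up for `T`
    -- and `R`, against the maximality of `T`.
    have trace_rank {Z : Matrix m n ℂ} (hZ : Z * Zᴴ * Z = Z) : (Zᴴ * Z).trace = Z.rank := by
      rw [Matrix.trace_eq_rank_of_isIdempotentElem, Matrix.rank_conjTranspose_mul_self]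
      rw [Matrix.mul_assoc, ← Matrix.mul_assoc Z, hZ]
    have hrank : (T + R).rank = T.rank + R.rank := by
      have := trace_rank hPsum.2
      rw [hsum, Matrix.trace_add, trace_rank hiso, trace_rank hpi] at this
      exact_mod_cast this.symm
    have hR0 : R.rank ≠ 0 := fun h0 => hne' (by
      have := trace_rank hpi
      rw [h0, Nat.cast_zero, Matrix.trace_conjTranspose_mul_self_eq_zero_iff] at this
      exact this)
    have := hmax _ hPsum
    omega
  -- The empty word gives the two complementary projections equal traces; this is where equality of
  -- the dimensions enters.
  have hq : 1 - T * Tᴴ = 0 := by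
    have h := trace_mul_eq_of_mem_span htr hT (c := (1, 1))
      (Submodule.subset_span ⟨[], by simp⟩)
    rw [hp, zero_mul, Matrix.trace_zero, mul_one] at h
    rw [← Matrix.trace_conjTranspose_mul_self_eq_zero_iff, h]
    congr 1
    simp only [Matrix.conjTranspose_sub, Matrix.conjTranspose_one, Matrix.conjTranspose_mul,
      Matrix.conjTranspose_conjTranspose, mul_sub, sub_mul, one_mul, mul_one]
    rw [show T * Tᴴ * (T * Tᴴ) = T * Tᴴ * T * Tᴴ by simp only [Matrix.mul_assoc], hiso]
    simp
  exact ⟨T, (sub_eq_zero.1 hp).symm, (sub_eq_zero.1 hq).symm, hT⟩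

end Specht

/-! ### Transport, quotients and sums of decompositions -/

section Decomposition

variable {ι ι' V V' : Type*}

/-- Decompositions can be transported along isomorphisms of the decomposition graph. -/
theorem IsDecomposition.reindex {T : SimpleGraph ι} {T' : SimpleGraph ι'} {F : SimpleGraph V}
    {β : ι → Finset V} (h : IsDecomposition T F β) (e : T' ≃g T) :
    IsDecomposition T' F (fun t => β (e t)) where
  cover x := by
    obtain ⟨t, ht⟩ := h.cover x
    exact ⟨e.symm t, by simpa using ht⟩
  edge x y hxy := by
    obtain ⟨t, ht⟩ := h.edge x y hxy
    exact ⟨e.symm t, by simpa using ht⟩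
  connected x := by
    have e' : T'.induce {t | x ∈ β (e t)} ≃g T.induce {t | x ∈ β t} :=
      { toEquiv := e.toEquiv.subtypeEquiv (fun t => Iff.rfl)
        map_rel_iff' := e.map_rel_iff }
    exact e'.connected_iff.2 (h.connected x)

/-- A decomposition induces one of a quotient graph, as long as the decomposition graph joins the
bags of identified vertices. -/
theorem IsDecomposition.quotient [DecidableEq V'] {T T' : SimpleGraph ι} {F : SimpleGraph V}
    {β : ι → Finset V} (h : IsDecomposition T F β) (hT : T ≤ T') {f : V → V'}
    (hf : Function.Surjective f) {r : V → V → Prop}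
    (hfr : ∀ a b, f a = f b ↔ Relation.EqvGen r a b)
    (hr : ∀ a b, r a b → ∃ t t', a ∈ β t ∧ b ∈ β t' ∧ T'.Adj t t')
    {F' : SimpleGraph V'} (hF : ∀ x y, F'.Adj x y → ∃ a b, F.Adj a b ∧ f a = x ∧ f b = y) :
    IsDecomposition T' F' (fun t => (β t).image f) where
  cover x := by
    obtain ⟨a, rfl⟩ := hf x
    obtain ⟨t, ht⟩ := h.cover a
    exact ⟨t, Finset.mem_image_of_mem f ht⟩
  edge x y hxy := by
    obtain ⟨a, b, hab, rfl, rfl⟩ := hF x y hxy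
    obtain ⟨t, ht, ht'⟩ := h.edge a b hab
    exact ⟨t, Finset.mem_image_of_mem f ht, Finset.mem_image_of_mem f ht'⟩
  connected x := by
    have same (a : V) (hx : f a = x) (s t) (hs : a ∈ β s) (ht : a ∈ β t) :
        (T'.induce {t | x ∈ (β t).image f}).Reachable
          ⟨s, hx ▸ Finset.mem_image_of_mem f hs⟩ ⟨t, hx ▸ Finset.mem_image_of_mem f ht⟩ := by
      let φ : T.induce {t | a ∈ β t} →g T'.induce {t | x ∈ (β t).image f} :=
        { toFun := fun t => ⟨t.1, hx ▸ Finset.mem_image_of_mem f t.2⟩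
          map_rel' := fun h => hT h }
      exact ((h.connected a).preconnected ⟨s, hs⟩ ⟨t, ht⟩).map φ
    have eqv (a b : V) (hab : Relation.EqvGen r a b) : ∀ (hx : f a = x) (hy : f b = x) (s t)
        (hs : a ∈ β s) (ht : b ∈ β t), (T'.induce {t | x ∈ (β t).image f}).Reachable
          ⟨s, hx ▸ Finset.mem_image_of_mem f hs⟩ ⟨t, hy ▸ Finset.mem_image_of_mem f ht⟩ := by
      induction hab with
      | rel a b hab =>
        intro hx hy s t hs ht
        obtain ⟨s', t', hs', ht', hadj⟩ := hr a b hab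
        refine ((same a hx s s' hs hs').trans ?_).trans (same b hy t' t ht' ht)
        exact SimpleGraph.Adj.reachable (by exact hadj)
      | refl a => exact fun hx _ s t hs ht => same a hx s t hs ht
      | symm a b _ ih => exact fun hx hy s t hs ht => (ih hy hx t s ht hs).symm
      | trans a b c hab _ ih ih' =>
        intro hx hy s t hs ht
        have hz : f b = x := ((hfr a b).2 hab).symm.trans hx
        -- The intermediate vertex of the chain lies in some bag, through which the two walks are
        -- joined.
        obtain ⟨u, hu⟩ := h.cover b
        exact (ih hx hz s u hs hu).trans (ih' hz hy u t hu ht)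
    obtain ⟨a, ha⟩ := hf x
    obtain ⟨s, hs⟩ := h.cover a
    refine SimpleGraph.connected_iff _ |>.2 ⟨?_, ⟨⟨s, ha ▸ Finset.mem_image_of_mem f hs⟩⟩⟩
    rintro ⟨t, ht⟩ ⟨t', ht'⟩
    obtain ⟨b, hb, hbx⟩ := Finset.mem_image.1 ht
    obtain ⟨b', hb', hbx'⟩ := Finset.mem_image.1 ht'
    exact eqv b b' ((hfr _ _).1 (hbx.trans hbx'.symm)) hbx hbx' t t' hb hb'

/-- The disjoint union of two decompositions. -/
theorem IsDecomposition.sum {T : SimpleGraph ι} {T' : SimpleGraph ι'} {F : SimpleGraph V}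
    {F' : SimpleGraph V'} {β : ι → Finset V} {β' : ι' → Finset V'} (h : IsDecomposition T F β)
    (h' : IsDecomposition T' F' β') :
    IsDecomposition (T ⊕g T') (F ⊕g F') (Sum.elim (fun t => (β t).map .inl)
      (fun t => (β' t).map .inr)) where
  cover x := by
    rcases x with x | x
    · obtain ⟨t, ht⟩ := h.cover x
      exact ⟨.inl t, by simpa using ht⟩
    · obtain ⟨t, ht⟩ := h'.cover x
      exact ⟨.inr t, by simpa using ht⟩
  edge x y hxy := by
    rcases x with x | x <;> rcases y with y | y
    · obtain ⟨t, ht⟩ := h.edge x y hxy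
      exact ⟨.inl t, by simpa using ht⟩
    · simp at hxy
    · simp at hxy
    · obtain ⟨t, ht⟩ := h'.edge x y hxy
      exact ⟨.inr t, by simpa using ht⟩
  connected x := by
    rcases x with x | x
    · let φ : T.induce {t | x ∈ β t} →g (T ⊕g T').induce {t | Sum.inl x ∈
          Sum.elim (fun t => (β t).map .inl) (fun t => (β' t).map .inr) t} :=
        { toFun := fun t => ⟨.inl t.1, by simpa using (show x ∈ β t.1 from t.2)⟩
          map_rel' := fun h => h }
      refine (h.connected x).map φ ?_
      rintro ⟨t | t, ht⟩
      · exact ⟨⟨t, by simpa using ht⟩, rfl⟩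
      · simp at ht
    · let φ : T'.induce {t | x ∈ β' t} →g (T ⊕g T').induce {t | Sum.inr x ∈
          Sum.elim (fun t => (β t).map .inl) (fun t => (β' t).map .inr) t} :=
        { toFun := fun t => ⟨.inr t.1, by simpa using (show x ∈ β' t.1 from t.2)⟩
          map_rel' := fun h => h }
      refine (h'.connected x).map φ ?_
      rintro ⟨t | t, ht⟩
      · simp at ht
      · exact ⟨⟨t, by simpa using ht⟩, rfl⟩

end Decomposition

/-! ### Path decompositions under concatenation and closure -/

namespace BilabelledGraph

variable {l m n k : ℕ}

/-- `P` has a path decomposition with `N + 2` nodes as required in `PathwidthAtMost`. -/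
def HasPathDecomposition (k N : ℕ) (P : BilabelledGraph (k + 1) (k + 1)) : Prop :=
  ∃ β : Fin (N + 2) → Finset P.V,
    IsDecomposition (SimpleGraph.pathGraph (N + 2)) P.graph β ∧ BagsWidthAtMost β k ∧
    (β 0 : Set P.V) = Set.range P.inn ∧ (β (Fin.last (N + 1)) : Set P.V) = Set.range P.out

theorem hasPathDecomposition_identity (k N : ℕ) :
    HasPathDecomposition k N (identity (k + 1)) := by
  let _ : Fintype (identity (k + 1)).V := inferInstanceAs (Fintype (Fin (k + 1)))
  refine ⟨fun _ => Finset.univ, ⟨fun x => ⟨0, Finset.mem_univ _⟩,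
    fun x y h => h.elim, fun x => ?_⟩, fun t => ?_, ?_, ?_⟩
  · have h : {t : Fin (N + 2) | x ∈ (Finset.univ : Finset (identity (k + 1)).V)} = Set.univ :=
      Set.eq_univ_of_forall fun _ => Finset.mem_univ x
    exact h ▸ (SimpleGraph.induceUnivIso _).connected_iff.2 (SimpleGraph.pathGraph_connected _)
  · exact (Finset.card_fin (k + 1)).le
  · exact (Finset.coe_univ (α := Fin (k + 1))).trans Set.range_id.symm
  · exact (Finset.coe_univ (α := Fin (k + 1))).trans Set.range_id.symm

/-- The two paths are laid end to end. Identified vertices lie in the out-leaf bag of `P` and the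
in-leaf bag of `Q`, which the new edge joins; taking images cannot enlarge bags. -/
theorem HasPathDecomposition.concat {N M : ℕ} {P Q : BilabelledGraph (k + 1) (k + 1)}
    (hP : HasPathDecomposition k N P) (hQ : HasPathDecomposition k M Q) (h : Composable P Q) :
    HasPathDecomposition k (N + M + 2) (P.concat Q h) := by
  classical
  obtain ⟨β, hβ, wβ, inβ, outβ⟩ := hP
  obtain ⟨γ, hγ, wγ, inγ, outγ⟩ := hQ
  let e : Fin (N + 2) ⊕ Fin (M + 2) ≃ Fin (N + M + 2 + 2) :=
    finSumFinEquiv.trans (finCongr (by omega))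
  have e_inl (i) : (e (.inl i)).val = i.val := rfl
  have e_inr (i) : (e (.inr i)).val = N + 2 + i.val := by simp [e]
  let T' := (SimpleGraph.pathGraph (N + M + 2 + 2)).comap e
  have hT : (SimpleGraph.pathGraph (N + 2)) ⊕g (SimpleGraph.pathGraph (M + 2)) ≤ T' := by
    rintro (a | a) (b | b) hab
    · simpa [T', SimpleGraph.pathGraph_adj, e_inl] using hab
    · simp at hab
    · simp at hab
    · simp [SimpleGraph.pathGraph_adj] at hab
      simp [T', SimpleGraph.pathGraph_adj, e_inr]
      omega
  have hquot := (hβ.sum hγ).quotient hT (f := Quot.mk (GlueRel P Q)) (V' := GlueVertex P Q)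
    Quot.mk_surjective (r := GlueRel P Q) (fun a b => Quot.eq) (by
      rintro _ _ ⟨i, rfl, rfl⟩
      refine ⟨.inl (Fin.last _), .inr 0, ?_, ?_, ?_⟩
      · have : P.out i ∈ (β (Fin.last (N + 1)) : Set P.V) := outβ ▸ Set.mem_range_self i
        simpa using this
      · have : Q.inn i ∈ (γ 0 : Set Q.V) := inγ ▸ Set.mem_range_self i
        simpa using this
      · simp [T', SimpleGraph.pathGraph_adj, e_inl, e_inr])
    (F' := (P.concat Q h).graph) (fun x y hxy => hxy)
  let iso : SimpleGraph.pathGraph (N + M + 2 + 2) ≃g T' := (SimpleGraph.Iso.comap e _).symm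
  have hiso (i) : iso i = e.symm i := rfl
  refine ⟨_, hquot.reindex iso, fun t => ?_, ?_, ?_⟩
  · refine Finset.card_image_le.trans ?_
    rcases iso t with s | s
    · simpa using wβ s
    · simpa using wγ s
  · have h0 : iso 0 = .inl 0 := by
      rw [hiso, Equiv.symm_apply_eq]
      exact Fin.ext (by simp [e_inl])
    rw [h0]
    refine (Finset.coe_image (α := P.V ⊕ Q.V) (β := GlueVertex P Q)).trans ?_
    simp only [Sum.elim_inl, Finset.coe_map, inβ, ← Set.range_comp]
    rfl
  · have h0 : iso (Fin.last _) = .inr (Fin.last _) := by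
      rw [hiso, Equiv.symm_apply_eq]
      exact Fin.ext (by simp [e_inr]; omega)
    rw [h0]
    refine (Finset.coe_image (α := P.V ⊕ Q.V) (β := GlueVertex P Q)).trans ?_
    simp only [Sum.elim_inr, Finset.coe_map, outγ, ← Set.range_comp]
    rfl

/-- The identification of the in-labels with the out-labels of `P`. -/
def ClosureRel (P : BilabelledGraph n n) (a b : P.V) : Prop :=
  ∃ i, a = P.out i ∧ b = P.inn i

/-- The graph obtained from `P` by identifying its in-labels with its out-labels. -/
def closure (P : BilabelledGraph n n)
    (h : ∀ a b, P.graph.Adj a b → Quot.mk P.ClosureRel a ≠ Quot.mk _ b) :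
    SimpleGraph (Quot P.ClosureRel) where
  Adj x y := ∃ a b, P.graph.Adj a b ∧ Quot.mk _ a = x ∧ Quot.mk _ b = y
  symm := ⟨fun _ _ ⟨a, b, hab, ha, hb⟩ => ⟨b, a, hab.symm, hb, ha⟩⟩
  loopless := ⟨fun _ ⟨a, b, hab, ha, hb⟩ => h a b hab (ha.trans hb.symm)⟩

/-- The edge that closes the path to a cycle joins exactly the bags of the identified labels. The
bound on `N` provides the three nodes a cycle needs. -/
theorem HasPathDecomposition.cyclewidthAtMost_closure {N : ℕ} (hN : 1 ≤ N)
    {P : BilabelledGraph (k + 1) (k + 1)} (hP : HasPathDecomposition k N P)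
    (h : ∀ a b, P.graph.Adj a b → Quot.mk P.ClosureRel a ≠ Quot.mk _ b) :
    CyclewidthAtMost k (P.closure h) := by
  classical
  obtain ⟨β, hβ, wβ, inβ, outβ⟩ := hP
  refine ⟨N + 2, _, by omega, hβ.quotient SimpleGraph.pathGraph_le_cycleGraph
    (f := Quot.mk P.ClosureRel) Quot.mk_surjective (r := P.ClosureRel) (fun a b => Quot.eq) ?_
    (fun x y hxy => hxy), fun t => Finset.card_image_le.trans (wβ t)⟩
  rintro _ _ ⟨i, rfl, rfl⟩
  refine ⟨Fin.last _, 0, ?_, ?_, ?_⟩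
  · have : P.out i ∈ (β (Fin.last (N + 1)) : Set P.V) := outβ ▸ Set.mem_range_self i
    simpa using this
  · have : P.inn i ∈ (β 0 : Set P.V) := inβ ▸ Set.mem_range_self i
    simpa using this
  · rw [SimpleGraph.cycleGraph_adj]
    right
    rw [sub_eq_iff_eq_add]
    exact ((add_comm _ _).trans (Fin.last_add_one (N + 1))).symm

end BilabelledGraph

/-! ### Homomorphism matrices: products, adjoints and traces -/

namespace BilabelledGraph

variable {l m n k : ℕ} {V : Type*}

/-- The homomorphisms counted by the entries of the homomorphism matrix. -/
abbrev LabelledHom (P : BilabelledGraph m n) (G : SimpleGraph V) (x : Fin m → V) (y : Fin n → V) :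
    Type _ :=
  {h : P.graph →g G // (∀ i, h (P.inn i) = x i) ∧ (∀ j, h (P.out j) = y j)}

instance (P : BilabelledGraph m n) (G : SimpleGraph V) [Finite V] : Finite (P.graph →g G) :=
  have := P.finite
  DFunLike.finite _

theorem homMatrix_apply (P : BilabelledGraph m n) (G : SimpleGraph V) (x y) :
    P.homMatrix G x y = Nat.card (P.LabelledHom G x y) := rfl

theorem homMatrix_congr {P Q : BilabelledGraph m n} (h : Isomorphic P Q) (G : SimpleGraph V) :
    P.homMatrix G = Q.homMatrix G := by
  obtain ⟨e, hin, hout⟩ := h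
  ext x y
  rw [homMatrix_apply, homMatrix_apply]
  refine congrArg _ (Nat.card_congr ?_)
  refine Equiv.subtypeEquiv
    { toFun := fun h => h.comp e.symm.toHom
      invFun := fun h => h.comp e.toHom
      left_inv := fun h => by ext; simp
      right_inv := fun h => by ext; simp } fun h => ?_
  simp [← hin, ← hout]

theorem homMatrix_reverse (P : BilabelledGraph m n) (G : SimpleGraph V) :
    P.reverse.homMatrix G = (P.homMatrix G)ᴴ := by
  ext x y
  rw [Matrix.conjTranspose_apply, homMatrix_apply, homMatrix_apply, star_natCast]
  exact congrArg _ (Nat.card_congr (Equiv.subtypeEquivRight fun h => and_comm))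

theorem homMatrix_identity [Fintype V] [DecidableEq V] (G : SimpleGraph V) :
    (identity n).homMatrix G = 1 := by
  ext x y
  rw [homMatrix_apply, Matrix.one_apply]
  split_ifs with hxy
  · subst hxy
    rw [Nat.card_eq_one_iff_unique.2 ⟨⟨?_⟩, ⟨⟨⟨x, fun h => h.elim⟩, fun _ => rfl, fun _ => rfl⟩⟩⟩,
      Nat.cast_one]
    rintro ⟨f, hf, -⟩ ⟨g, hg, -⟩
    exact Subtype.ext (RelHom.ext fun i => (hf i).trans (hg i).symm)
  · have : IsEmpty ((identity n).LabelledHom G x y) :=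
      ⟨fun ⟨f, hf, hg⟩ => hxy (funext fun i => (hf i).symm.trans (hg i))⟩
    rw [Nat.card_of_isEmpty, Nat.cast_zero]

/-- Labelled homomorphisms from a concatenation are pairs of compatible homomorphisms. -/
def labelledHomConcatEquiv (P : BilabelledGraph l m) (Q : BilabelledGraph m n)
    (hPQ : Composable P Q) (G : SimpleGraph V) (x : Fin l → V) (z : Fin n → V) :
    (P.concat Q hPQ).LabelledHom G x z ≃
      Σ y : Fin m → V, P.LabelledHom G x y × Q.LabelledHom G y z where
  toFun h := ⟨fun i => h.1 (Quot.mk _ (.inl (P.out i))),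
    ⟨⟨fun v => h.1 (Quot.mk _ (.inl v)), fun {a b} hab => h.1.map_rel
      (show (P.concat Q hPQ).graph.Adj _ _ from ⟨.inl a, .inl b, hab, rfl, rfl⟩)⟩, h.2.1,
      fun _ => rfl⟩,
    ⟨⟨fun v => h.1 (Quot.mk _ (.inr v)), fun {a b} hab => h.1.map_rel
      (show (P.concat Q hPQ).graph.Adj _ _ from ⟨.inr a, .inr b, hab, rfl, rfl⟩)⟩,
      fun i => congrArg h.1 (Quot.sound ⟨i, rfl, rfl⟩).symm, h.2.2⟩⟩
  invFun h := ⟨⟨Quot.lift (Sum.elim h.2.1.1 h.2.2.1) (by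
      rintro _ _ ⟨i, rfl, rfl⟩
      exact (h.2.1.2.2 i).trans (h.2.2.2.1 i).symm), by
      rintro _ _ ⟨a | a, b | b, hab, rfl, rfl⟩
      · exact h.2.1.1.map_rel hab
      · simp at hab
      · simp at hab
      · exact h.2.2.1.map_rel hab⟩, h.2.1.2.1, h.2.2.2.2⟩
  left_inv h := by
    refine Subtype.ext (RelHom.ext ?_)
    rintro ⟨a | a⟩ <;> rfl
  right_inv h := by
    obtain ⟨y, ⟨p, hp, hp'⟩, ⟨q, hq, hq'⟩⟩ := h
    obtain rfl : (fun i => p (P.out i)) = y := funext hp'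
    rfl

theorem homMatrix_concat [Fintype V] (P : BilabelledGraph l m) (Q : BilabelledGraph m n)
    (hPQ : Composable P Q) (G : SimpleGraph V) :
    (P.concat Q hPQ).homMatrix G = P.homMatrix G * Q.homMatrix G := by
  ext x z
  rw [Matrix.mul_apply, homMatrix_apply, Nat.card_congr (labelledHomConcatEquiv P Q hPQ G x z),
    Nat.card_sigma]
  simp [homMatrix_apply, Nat.card_prod]

/-- A compatible pair of homomorphisms would factor through the glued vertices and send the ends of
the collapsed edge to a single vertex of the loopless `G`. -/
theorem homMatrix_mul_eq_zero [Fintype V] (P : BilabelledGraph l m) (Q : BilabelledGraph m n)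
    (hPQ : ¬ Composable P Q) (G : SimpleGraph V) : P.homMatrix G * Q.homMatrix G = 0 := by
  ext x z
  rw [Matrix.mul_apply]
  refine Finset.sum_eq_zero fun y _ => ?_
  rw [homMatrix_apply, homMatrix_apply, ← Nat.cast_mul, ← Nat.card_prod, Nat.cast_eq_zero]
  have : IsEmpty (P.LabelledHom G x y × Q.LabelledHom G y z) := by
    refine ⟨fun ⟨p, q⟩ => hPQ fun a b hab heq => ?_⟩
    let f : GlueVertex P Q → V := Quot.lift (Sum.elim p.1 q.1) (by
      rintro _ _ ⟨i, rfl, rfl⟩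
      exact (p.2.2 i).trans (q.2.1 i).symm)
    have hf := congrArg f heq
    rcases a with a | a <;> rcases b with b | b
    · exact (p.1.map_rel hab).ne hf
    · simp at hab
    · simp at hab
    · exact (q.1.map_rel hab).ne hf
  exact Nat.card_of_isEmpty

/-- Homomorphisms that agree on the in-labels and on the out-labels. -/
abbrev ClosedHom (P : BilabelledGraph n n) (G : SimpleGraph V) : Type _ :=
  {h : P.graph →g G // ∀ i, h (P.out i) = h (P.inn i)}

theorem trace_homMatrix [Fintype V] (P : BilabelledGraph n n) (G : SimpleGraph V) :
    (P.homMatrix G).trace = Nat.card (P.ClosedHom G) := by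
  have e : P.ClosedHom G ≃ Σ x : Fin n → V, P.LabelledHom G x x :=
    { toFun := fun h => ⟨fun i => h.1 (P.inn i), h.1, fun _ => rfl, h.2⟩
      invFun := fun h => ⟨h.2.1, fun i => (h.2.2.2 i).trans (h.2.2.1 i).symm⟩
      left_inv := fun h => rfl
      right_inv := fun h => by
        obtain ⟨x, h, hx, hx'⟩ := h
        obtain rfl : (fun i => h (P.inn i)) = x := funext hx
        rfl }
  rw [Nat.card_congr e, Nat.card_sigma]
  simp [Matrix.trace, homMatrix_apply]

theorem trace_homMatrix_eq_homCount_closure [Fintype V] (P : BilabelledGraph n n)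
    (hP : ∀ a b, P.graph.Adj a b → Quot.mk P.ClosureRel a ≠ Quot.mk _ b) (G : SimpleGraph V) :
    (P.homMatrix G).trace = homCount (P.closure hP) G := by
  have e : P.ClosedHom G ≃ (P.closure hP →g G) :=
    { toFun := fun h => ⟨Quot.lift h.1 (by rintro _ _ ⟨i, rfl, rfl⟩; exact h.2 i), by
        rintro _ _ ⟨a, b, hab, rfl, rfl⟩
        exact h.1.map_rel hab⟩
      invFun := fun h => ⟨⟨fun a => h (Quot.mk _ a), fun {a b} hab => h.map_rel
        (show (P.closure hP).Adj _ _ from ⟨a, b, hab, rfl, rfl⟩)⟩,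
        fun i => congrArg h (Quot.sound ⟨i, rfl, rfl⟩)⟩
      left_inv := fun h => rfl
      right_inv := fun h => RelHom.ext (by rintro ⟨a⟩; rfl) }
  rw [trace_homMatrix, homCount, Nat.card_congr e]

theorem trace_homMatrix_eq_zero [Fintype V] (P : BilabelledGraph n n)
    (hP : ¬ ∀ a b, P.graph.Adj a b → Quot.mk P.ClosureRel a ≠ Quot.mk _ b) (G : SimpleGraph V) :
    (P.homMatrix G).trace = 0 := by
  have : IsEmpty (P.ClosedHom G) := by
    refine ⟨fun h => hP fun a b hab heq => (h.1.map_rel hab).ne ?_⟩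
    exact congrArg (Quot.lift h.1 (by rintro _ _ ⟨i, rfl, rfl⟩; exact h.2 i)) heq
  rw [trace_homMatrix, Nat.card_of_isEmpty, Nat.cast_zero]

/-! ### From indistinguishability to the unitary matrix -/

section Indistinguishable

variable {W : Type*} [Fintype V] [DecidableEq V] [Fintype W] [DecidableEq W]
  {G : SimpleGraph V} {H : SimpleGraph W}

omit [DecidableEq V] [DecidableEq W] in
theorem trace_homMatrix_eq_of_homIndistinguishable
    (hGH : HomIndistinguishable (fun _ F => CyclewidthAtMost k F) G H)
    {P : BilabelledGraph (k + 1) (k + 1)} {N : ℕ} (hN : 1 ≤ N) (hP : HasPathDecomposition k N P) :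
    (P.homMatrix G).trace = (P.homMatrix H).trace := by
  by_cases h : ∀ a b, P.graph.Adj a b → Quot.mk P.ClosureRel a ≠ Quot.mk _ b
  · have := P.finite
    rw [trace_homMatrix_eq_homCount_closure P h, trace_homMatrix_eq_homCount_closure P h,
      hGH _ _ (hP.cyclewidthAtMost_closure hN h)]
  · rw [trace_homMatrix_eq_zero P h, trace_homMatrix_eq_zero P h]

theorem trace_word_eq_of_homIndistinguishable
    (hGH : HomIndistinguishable (fun _ F => CyclewidthAtMost k F) G H)
    {S : Set (BilabelledGraph (k + 1) (k + 1))} (hS : ∀ B ∈ S, PathwidthAtMost k B) (w : List S) :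
    ((w.map fun B : S => B.1.homMatrix G).prod).trace =
      ((w.map fun B : S => B.1.homMatrix H).prod).trace := by
  -- A word is either realised by one bilabelled graph or vanishes over both graphs. The bound `1 ≤
  -- N` is kept for the later closing into a cycle, so the empty word uses the identity with three
  -- bags.
  have key : (∃ N P, 1 ≤ N ∧ HasPathDecomposition k N P ∧
      P.homMatrix G = (w.map fun B : S => B.1.homMatrix G).prod ∧
      P.homMatrix H = (w.map fun B : S => B.1.homMatrix H).prod) ∨
      (w.map fun B : S => B.1.homMatrix G).prod = 0 ∧ (w.map fun B : S => B.1.homMatrix H).prod = 0 := by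
    induction w with
    | nil => exact .inl ⟨1, _, le_rfl, hasPathDecomposition_identity k 1, by
        simp [homMatrix_identity], by simp [homMatrix_identity]⟩
    | cons B w ih =>
      simp only [List.map_cons, List.prod_cons]
      rcases ih with ⟨N, P, -, hP, hG, hH⟩ | ⟨hG, hH⟩
      · rw [← hG, ← hH]
        by_cases hc : Composable B.1 P
        · obtain ⟨M, hM⟩ := hS _ B.2
          exact .inl ⟨M + N + 2, B.1.concat P hc, by omega, HasPathDecomposition.concat hM hP hc,
            homMatrix_concat _ _ _ _, homMatrix_concat _ _ _ _⟩
        · exact .inr ⟨homMatrix_mul_eq_zero _ _ hc _, homMatrix_mul_eq_zero _ _ hc _⟩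
      · exact .inr ⟨by rw [hG, mul_zero], by rw [hH, mul_zero]⟩
  rcases key with ⟨N, P, hN, hP, hG, hH⟩ | ⟨hG, hH⟩
  · rw [← hG, ← hH, trace_homMatrix_eq_of_homIndistinguishable hGH hN hP]
  · rw [hG, hH, Matrix.trace_zero, Matrix.trace_zero]

theorem exists_unitary_of_homIndistinguishable {S : Set (BilabelledGraph (k + 1) (k + 1))}
    (hS : IsBasal k S) (hGH : HomIndistinguishable (fun _ F => CyclewidthAtMost k F) G H) :
    ∃ U : Matrix (Fin (k + 1) → W) (Fin (k + 1) → V) ℂ,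
      Uᴴ * U = 1 ∧ U * Uᴴ = 1 ∧ ∀ B ∈ S, U * B.homMatrix G = B.homMatrix H * U := by
  obtain ⟨U, hU, hU', h⟩ := exists_unitary_intertwiner_of_trace_words_eq
    (A := fun B : S => B.1.homMatrix G) (B := fun B : S => B.1.homMatrix H)
    (trace_word_eq_of_homIndistinguishable hGH hS.pathwidth) (by
      rintro ⟨B, hB⟩
      obtain ⟨B', hB', hiso⟩ := hS.reverse B hB
      exact ⟨⟨B', hB'⟩, by simp only [homMatrix_congr hiso, homMatrix_reverse],
        by simp only [homMatrix_congr hiso, homMatrix_reverse]⟩)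
  exact ⟨U, hU, hU', fun B hB => h ⟨B, hB⟩⟩

omit [DecidableEq V] [DecidableEq W] in
theorem Generated.intertwines {S : Set (BilabelledGraph n n)}
    {U : Matrix (Fin n → W) (Fin n → V) ℂ}
    (hU : ∀ B ∈ S, U * B.homMatrix G = B.homMatrix H * U) {P : BilabelledGraph n n}
    (hP : Generated S P) : U * P.homMatrix G = P.homMatrix H * U := by
  induction hP with
  | of_mem B hB => exact hU B hB
  | concat P B h _ hB ih =>
    rw [homMatrix_concat, homMatrix_concat, ← Matrix.mul_assoc, ih, Matrix.mul_assoc, hU B hB,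
      Matrix.mul_assoc]
  | of_isomorphic P Q h _ ih => rw [← homMatrix_congr h, ← homMatrix_congr h, ih]

end Indistinguishable

end BilabelledGraph

/-! ### Nonempty bags, and traces as sums over closed walks -/

section CycleDecomposition

variable {ι X V W : Type*}

/-- In a decomposition over a connected graph one may assume that no bag is empty. -/
theorem IsDecomposition.exists_nonempty_bags [Fintype ι] [Nonempty X] {T : SimpleGraph ι}
    (hT : T.Connected) {F : SimpleGraph X} {k : ℕ} {β : ι → Finset X}
    (h : IsDecomposition T F β) (hw : BagsWidthAtMost β k) :
    ∃ γ : ι → Finset X, IsDecomposition T F γ ∧ BagsWidthAtMost γ k ∧ ∀ t, (γ t).Nonempty := by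
  classical
  induction hc : (Finset.univ.filter fun t => β t = ∅).card using Nat.strong_induction_on
    generalizing β with
  | _ c ih =>
    by_cases hne : ∀ t, (β t).Nonempty
    · exact ⟨β, h, hw, hne⟩
    · push Not at hne
      obtain ⟨t₀, ht₀⟩ := hne
      obtain ⟨s₀, hs₀⟩ := h.cover (Classical.arbitrary X)
      -- Connectedness yields an edge from a nonempty to an empty bag. Copying the former into the
      -- latter only adds a neighbouring node to the node sets of its vertices, and lowers the
      -- number of empty bags.
      obtain ⟨s, t, hst, hs, ht⟩ : ∃ s t, T.Adj s t ∧ β s ≠ ∅ ∧ β t = ∅ := by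
        obtain ⟨p⟩ := hT.preconnected s₀ t₀
        obtain ⟨d, -, hd, hd'⟩ := p.exists_boundary_dart {t | β t ≠ ∅}
          (Finset.ne_empty_of_mem hs₀) (by simpa using ht₀)
        exact ⟨d.fst, d.snd, d.adj, hd, by simpa using hd'⟩
      refine ih _ ?_ (β := Function.update β t (β s)) ⟨fun x => ?_, fun x y hxy => ?_, fun x => ?_⟩
        (fun u => ?_) rfl
      · rw [← hc]
        refine Finset.card_lt_card (Finset.ssubset_iff_subset_ne.2 ⟨fun u => ?_, fun heq => ?_⟩)
        · rcases eq_or_ne u t with rfl | hu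
          · simp [hs]
          · simp [hu]
        · have := (Finset.ext_iff.1 heq t).2 (by simp [ht])
          simp [hs] at this
      · obtain ⟨u, hu⟩ := h.cover x
        have : u ≠ t := by rintro rfl; simp [ht] at hu
        exact ⟨u, by simpa [this] using hu⟩
      · obtain ⟨u, hu⟩ := h.edge x y hxy
        have : u ≠ t := by rintro rfl; simp [ht] at hu
        exact ⟨u, by simpa [this] using hu⟩
      · by_cases hx : x ∈ β s
        · have hset : {u | x ∈ Function.update β t (β s) u} = {u | x ∈ β u} ∪ {s, t} := by
            ext u
            rcases eq_or_ne u t with rfl | hu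
            · simp [hx]
            · rcases eq_or_ne u s with rfl | hu'
              · simp [hx, hu]
              · simp [hu, hu']
          rw [hset]
          exact SimpleGraph.induce_union_connected (h.connected x).preconnected
            (SimpleGraph.induce_pair_connected_of_adj hst).preconnected ⟨s, hx, by simp⟩
        · have hset : {u | x ∈ Function.update β t (β s) u} = {u | x ∈ β u} := by
            ext u
            rcases eq_or_ne u t with rfl | hu
            · simp [hx, ht]
            · simp [hu]
          rw [hset]
          exact h.connected x
      · rcases eq_or_ne u t with rfl | hu
        · simpa using hw s
        · simpa [hu] using hw u

/-- An entry of a product of matrices as a sum over walks. -/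
theorem prod_ofFn_apply {R : Type*} [CommSemiring R] [Fintype ι] [DecidableEq ι] (m : ℕ)
    (D : Fin (m + 1) → Matrix ι ι R) (a b : ι) : (List.ofFn D).prod a b =
      ∑ x : Fin m → ι, ∏ i, D i (Fin.cons (α := fun _ => ι) a x i)
        (Fin.snoc (α := fun _ => ι) x b i) := by
  induction m generalizing a with
  | zero => simp [Fin.snoc]
  | succ m ih =>
    rw [List.ofFn_succ, List.prod_cons, Matrix.mul_apply, ← (Fin.consEquiv fun _ => ι).sum_comp,
      Fintype.sum_prod_type]
    refine Finset.sum_congr rfl fun c _ => ?_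
    rw [ih, Finset.mul_sum]
    refine Finset.sum_congr rfl fun x _ => ?_
    refine Eq.trans ?_ (Fin.prod_univ_succ _).symm
    simp [Fin.consEquiv, ← Fin.cons_snoc_eq_snoc_cons]

/-- The trace of a product of matrices as a sum over closed walks. -/
theorem trace_prod_ofFn {R : Type*} [CommSemiring R] [Fintype ι] [DecidableEq ι] (m : ℕ)
    (D : Fin (m + 1) → Matrix ι ι R) :
    (List.ofFn D).prod.trace = ∑ x : Fin (m + 1) → ι, ∏ i, D i (x i) (x (i + 1)) := by
  rw [← (Fin.consEquiv fun _ => ι).sum_comp, Fintype.sum_prod_type]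
  refine Finset.sum_congr rfl fun a _ => ?_
  rw [Matrix.diag_apply, prod_ofFn_apply]
  refine Finset.sum_congr rfl fun x _ => Finset.prod_congr rfl fun i _ => ?_
  congr 1
  -- At the last index `i + 1` wraps around to `0`, so the walk returns to `a`.
  cases i using Fin.lastCases with
  | last => simp [Fin.consEquiv]
  | cast i => simp [Fin.consEquiv, Fin.coeSucc_eq_succ]

end CycleDecomposition

/-! ### From the unitary matrix to indistinguishability -/

namespace BilabelledGraph

variable {k : ℕ} {X : Type} {V W : Type*}

/-- The subgraph of `F` consisting of the edges in the bags `s` and `t`, with in-labels `u`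
enumerating `s` and out-labels `v` enumerating `t`. -/
def bagPair [Finite X] (F : SimpleGraph X) (s t : Finset X) (u v : Fin (k + 1) → X)
    (hu : Set.range u = s) (hv : Set.range v = t) : BilabelledGraph (k + 1) (k + 1) where
  V := {x // x ∈ s ∨ x ∈ t}
  finite := inferInstance
  graph :=
    { Adj := fun x y => F.Adj x.1 y.1 ∧ (x.1 ∈ s ∧ y.1 ∈ s ∨ x.1 ∈ t ∧ y.1 ∈ t)
      symm := ⟨fun _ _ h => ⟨h.1.symm, h.2.imp And.symm And.symm⟩⟩
      loopless := ⟨fun _ h => h.1.ne rfl⟩ }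
  inn j := ⟨u j, .inl (Finset.mem_coe.1 (hu ▸ Set.mem_range_self j))⟩
  out j := ⟨v j, .inr (Finset.mem_coe.1 (hv ▸ Set.mem_range_self j))⟩

variable [Finite X] {F : SimpleGraph X} {s t : Finset X} {u v : Fin (k + 1) → X}
  (hu : Set.range u = s) (hv : Set.range v = t)

theorem pathwidthAtMost_bagPair (hs : s.card ≤ k + 1) (ht : t.card ≤ k + 1) :
    PathwidthAtMost k (bagPair F s t u v hu hv) := by
  classical
  let β (i : Fin 2) : Finset {x // x ∈ s ∨ x ∈ t} := (if i = 0 then s else t).subtype _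
  have mem (i : Fin 2) (x) : x ∈ β i ↔ x.1 ∈ if i = 0 then s else t := Finset.mem_subtype
  refine ⟨0, β, ⟨fun x => ?_, fun x y hxy => ?_, fun x => ?_⟩, fun i => ?_, ?_, ?_⟩
  · rcases x.2 with h | h
    · exact ⟨0, (mem 0 x).2 h⟩
    · exact ⟨1, (mem 1 x).2 h⟩
  · rcases hxy.2 with h | h
    · exact ⟨0, (mem 0 x).2 h.1, (mem 0 y).2 h.2⟩
    · exact ⟨1, (mem 1 x).2 h.1, (mem 1 y).2 h.2⟩
  · rw [SimpleGraph.pathGraph_two_eq_top]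
    refine (SimpleGraph.connected_iff _).2 ⟨fun i j => ?_, ?_⟩
    · rcases eq_or_ne i j with rfl | hij
      · exact .refl _
      · exact SimpleGraph.Adj.reachable (fun h => hij (Subtype.ext h))
    · rcases x.2 with h | h
      · exact ⟨0, (mem 0 x).2 h⟩
      · exact ⟨1, (mem 1 x).2 h⟩
  · refine (Finset.card_subtype _ _).le.trans ((Finset.card_filter_le _ _).trans ?_)
    split_ifs <;> assumption
  · ext x
    refine (mem 0 x).trans ?_
    rw [if_pos rfl, ← Finset.mem_coe, ← hu]
    exact exists_congr fun j =>
      ⟨fun h => Subtype.ext h, fun h => congrArg Subtype.val h⟩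
  · ext x
    refine (mem 1 x).trans ?_
    rw [if_neg (by decide), ← Finset.mem_coe, ← hv]
    exact exists_congr fun j =>
      ⟨fun h => Subtype.ext h, fun h => congrArg Subtype.val h⟩

-- Every vertex of the piece carries a label, so a homomorphism is determined by the label images
-- and the entries are zero or one.
open scoped Classical in
theorem homMatrix_bagPair (G : SimpleGraph V) (x y) :
    (bagPair F s t u v hu hv).homMatrix G x y =
      if Nonempty ((bagPair F s t u v hu hv).LabelledHom G x y) then 1 else 0 := by
  rw [homMatrix_apply]
  split_ifs with h
  · rw [Nat.card_eq_one_iff_unique.2 ⟨⟨?_⟩, h⟩, Nat.cast_one]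
    rintro ⟨f, hf, hf'⟩ ⟨g, hg, hg'⟩
    refine Subtype.ext (RelHom.ext ?_)
    rintro ⟨a, ha | ha⟩
    · rw [← Finset.mem_coe, ← hu] at ha
      obtain ⟨j, rfl⟩ := ha
      exact (hf j).trans (hg j).symm
    · rw [← Finset.mem_coe, ← hv] at ha
      obtain ⟨j, rfl⟩ := ha
      exact (hf' j).trans (hg' j).symm
  · rw [not_nonempty_iff] at h
    rw [Nat.card_of_isEmpty, Nat.cast_zero]

omit [Finite X] in
theorem eq_of_reachable {ι α : Type*} {T : SimpleGraph ι} {f : ι → α}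
    (hf : ∀ s t, T.Adj s t → f s = f t) {s t : ι} (h : T.Reachable s t) : f s = f t := by
  obtain ⟨p⟩ := h
  induction p with
  | nil => rfl
  | cons h _ ih => exact (hf _ _ h).trans ih

/-- The pieces into which a cycle decomposition with enumerated bags cuts a graph. -/
abbrev cyclePiece {m : ℕ} (F : SimpleGraph X) (β : Fin (m + 2) → Finset X)
    (u : Fin (m + 2) → Fin (k + 1) → X) (hu : ∀ i, Set.range (u i) = β i) (i : Fin (m + 2)) :
    BilabelledGraph (k + 1) (k + 1) :=
  bagPair F (β i) (β (i + 1)) (u i) (u (i + 1)) (hu i) (hu (i + 1))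

variable {m : ℕ} {β : Fin (m + 2) → Finset X} {w : Fin (m + 2) → Fin (k + 1) → X}

/-- A homomorphism is recorded by its values along the enumerated bags. Conversely, homomorphisms of
consecutive pieces agree on shared bags, and connectedness of the nodes containing a vertex spreads
this agreement to all its bags. -/
theorem homCount_eq_card_closed_walks
    (h : IsDecomposition (SimpleGraph.cycleGraph (m + 2)) F β) (hw : ∀ i, Set.range (w i) = β i)
    (G : SimpleGraph V) : homCount F G = Nat.card {x : Fin (m + 2) → Fin (k + 1) → V //
      ∀ i, Nonempty ((cyclePiece F β w hw i).LabelledHom G (x i) (x (i + 1)))} := by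
  have mem (i j) : w i j ∈ β i := Finset.mem_coe.1 (hw i ▸ Set.mem_range_self j)
  refine Nat.card_eq_of_bijective (fun f => ⟨fun i j => f (w i j), fun i =>
    ⟨⟨fun a => f a.1, fun hab => f.map_rel hab.1⟩, fun _ => rfl, fun _ => rfl⟩⟩) ⟨?_, ?_⟩
  · intro f g hfg
    refine RelHom.ext fun a => ?_
    obtain ⟨i, hi⟩ := h.cover a
    rw [← Finset.mem_coe, ← hw] at hi
    obtain ⟨j, rfl⟩ := hi
    exact congrFun (congrFun (congrArg Subtype.val hfg) i) j
  · rintro ⟨x, hx⟩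
    let g (i) := (hx i).some
    have inn (i j) (hj) : (g i).1 ⟨w i j, .inl hj⟩ = x i j := (g i).2.1 j
    have out (i j) (hj) : (g i).1 ⟨w (i + 1) j, .inr hj⟩ = x (i + 1) j := (g i).2.2 j
    have agree (a : X) (i i') (hi : a ∈ β i) (hi' : a ∈ β i') :
        (g i).1 ⟨a, .inl hi⟩ = (g i').1 ⟨a, .inl hi'⟩ := by
      have succ (i) (hi : a ∈ β i) (hi' : a ∈ β (i + 1)) :
          (g i).1 ⟨a, .inl hi⟩ = (g (i + 1)).1 ⟨a, .inl hi'⟩ := by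
        obtain ⟨j, rfl⟩ : a ∈ Set.range (w (i + 1)) := hw (i + 1) ▸ Finset.mem_coe.2 hi'
        exact (out i j hi').trans (inn (i + 1) j hi').symm
      refine eq_of_reachable (f := fun i : {i | a ∈ β i} => (g i).1 ⟨a, .inl i.2⟩) ?_
        ((h.connected a).preconnected ⟨i, hi⟩ ⟨i', hi'⟩)
      rintro ⟨i, hi⟩ ⟨i', hi'⟩ hadj
      rcases SimpleGraph.cycleGraph_adj.1 hadj with hadj | hadj
      · obtain rfl : i = i' + 1 := sub_eq_iff_eq_add.1 hadj |>.trans (add_comm 1 _)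
        exact (succ i' hi' hi).symm
      · obtain rfl : i' = i + 1 := sub_eq_iff_eq_add.1 hadj |>.trans (add_comm 1 _)
        exact succ i hi hi'
    choose τ hτ using h.cover
    refine ⟨⟨fun a => (g (τ a)).1 ⟨a, .inl (hτ a)⟩, fun {a b} hab => ?_⟩, Subtype.ext ?_⟩
    · obtain ⟨i, ha, hb⟩ := h.edge a b hab
      rw [agree a _ i (hτ a) ha, agree b _ i (hτ b) hb]
      exact (g i).1.map_rel ⟨hab, .inl ⟨ha, hb⟩⟩
    · funext i j
      exact (agree _ _ i (hτ _) (mem i j)).trans (inn i j (mem i j))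

/-- The number of homomorphisms from a graph with a cycle decomposition is a trace. -/
theorem homCount_eq_trace [Fintype V] [DecidableEq V]
    (h : IsDecomposition (SimpleGraph.cycleGraph (m + 2)) F β) (hw : ∀ i, Set.range (w i) = β i)
    (G : SimpleGraph V) : (homCount F G : ℂ) =
      (List.ofFn fun i => (cyclePiece F β w hw i).homMatrix G).prod.trace := by
  classical
  rw [trace_prod_ofFn, homCount_eq_card_closed_walks h hw]
  simp only [homMatrix_bagPair, Finset.prod_ite_zero, Finset.mem_univ, true_imp_iff,
    Finset.prod_const_one]
  rw [Finset.sum_boole, Nat.card_eq_fintype_card, Fintype.card_subtype]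

theorem trace_prod_eq_of_intertwines {ι κ σ : Type*} [Fintype ι] [DecidableEq ι] [Fintype κ]
    [DecidableEq κ] {A : σ → Matrix ι ι ℂ} {B : σ → Matrix κ κ ℂ} {U : Matrix κ ι ℂ}
    (hU : Uᴴ * U = 1) (hU' : U * Uᴴ = 1) (l : List σ) (h : ∀ s ∈ l, U * A s = B s * U) :
    (l.map A).prod.trace = (l.map B).prod.trace := by
  have key : U * (l.map A).prod = (l.map B).prod * U := by
    induction l with
    | nil => simp
    | cons s l ih =>
      rw [List.map_cons, List.prod_cons, List.map_cons, List.prod_cons, ← Matrix.mul_assoc,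
        h s List.mem_cons_self, Matrix.mul_assoc, ih fun t ht => h t (List.mem_cons_of_mem _ ht),
        Matrix.mul_assoc]
  rw [← Matrix.one_mul (l.map A).prod, ← hU, Matrix.mul_assoc, key, ← Matrix.mul_assoc,
    Matrix.trace_mul_comm, ← Matrix.mul_assoc, hU', Matrix.one_mul]

omit [Finite X] in
theorem homCount_eq_of_unitary [Fintype V] [DecidableEq V] [Fintype W] [DecidableEq W]
    {G : SimpleGraph V} {H : SimpleGraph W} {S : Set (BilabelledGraph (k + 1) (k + 1))}
    (hS : IsBasal k S) {U : Matrix (Fin (k + 1) → W) (Fin (k + 1) → V) ℂ}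
    (hU : Uᴴ * U = 1) (hU' : U * Uᴴ = 1) (h : ∀ B ∈ S, U * B.homMatrix G = B.homMatrix H * U) :
    HomIndistinguishable (fun _ F => CyclewidthAtMost k F) G H := by
  rintro X _ F ⟨n, β, hn, hβ, hwidth⟩
  -- Without vertices no bag can be made nonempty, so this case is counted directly.
  cases isEmpty_or_nonempty X with
  | inl hX =>
    have one_G : homCount F G = 1 := Nat.card_eq_one_iff_unique.2
      ⟨⟨fun f g => RelHom.ext fun a => hX.elim a⟩,
        ⟨⟨fun a => hX.elim a, fun {a} => hX.elim a⟩⟩⟩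
    have one_H : homCount F H = 1 := Nat.card_eq_one_iff_unique.2
      ⟨⟨fun f g => RelHom.ext fun a => hX.elim a⟩,
        ⟨⟨fun a => hX.elim a, fun {a} => hX.elim a⟩⟩⟩
    rw [one_G, one_H]
  | inr hX =>
    obtain ⟨m, rfl⟩ : ∃ m, n = m + 2 := ⟨n - 2, by omega⟩
    obtain ⟨γ, hγ, wγ, nγ⟩ := hβ.exists_nonempty_bags SimpleGraph.cycleGraph_connected hwidth
    -- A nonempty set of at most `k + 1` vertices is the range of a tuple with repetitions, obtained
    -- by inverting an injection into `Fin (k + 1)`.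
    have enum (i : Fin (m + 2)) : ∃ w : Fin (k + 1) → X, Set.range w = γ i := by
      have : Nonempty (γ i) := (nγ i).to_subtype
      obtain ⟨f, hf⟩ : ∃ f : Fin (k + 1) → γ i, Function.Surjective f := by
        obtain ⟨e⟩ := Function.Embedding.nonempty_of_card_le (α := γ i) (β := Fin (k + 1))
          (by simpa using wγ i)
        exact ⟨_, Function.invFun_surjective e.injective⟩
      exact ⟨fun j => f j, by rw [← Function.comp_def, hf.range_comp]; simp⟩
    choose w hw using enum
    have hint (i) : U * (cyclePiece F γ w hw i).homMatrix G =
        (cyclePiece F γ w hw i).homMatrix H * U :=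
      (hS.generates _ (pathwidthAtMost_bagPair _ _ (wγ _) (wγ _))).intertwines h
    have := trace_prod_eq_of_intertwines hU hU' (List.finRange (m + 2)) fun i _ => hint i
    rw [← List.ofFn_eq_map, ← List.ofFn_eq_map, ← homCount_eq_trace hγ hw,
      ← homCount_eq_trace hγ hw] at this
    exact_mod_cast this

end BilabelledGraph

theorem mainTheorem7 {V W : Type*} [Fintype V] [DecidableEq V] [Fintype W] [DecidableEq W]
    (G : SimpleGraph V) (H : SimpleGraph W) (k : ℕ) (hk : 1 ≤ k)
    (S : Set (BilabelledGraph (k + 1) (k + 1))) (hS : BilabelledGraph.IsBasal k S) :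
    HomIndistinguishable (fun _ F => CyclewidthAtMost k F) G H ↔
      ∃ U : Matrix (Fin (k + 1) → W) (Fin (k + 1) → V) ℂ,
        Uᴴ * U = 1 ∧ U * Uᴴ = 1 ∧ ∀ B ∈ S, U * B.homMatrix G = B.homMatrix H * U :=
  ⟨BilabelledGraph.exists_unitary_of_homIndistinguishable hS,
    fun ⟨_, hU, hU', h⟩ => BilabelledGraph.homCount_eq_of_unitary hS hU hU' h⟩
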